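/- Let $A$ be a finite alphabet. Write $A^+$ for the set of nonempty finite words over $A$ and $A^\infty$ for the set of infinite words over $A$. An $\omega$-semigroup is a pair $(S_+,S_\infty)$, where $S_+$ is a semigroup and $S_\infty$ is a set, together with a mixed product $S_+\times S_\infty\to S_\infty$, $(s,x)\mapsto sx$, and an infinite product mapping each sequence $s_0,s_1,\dots$ in $S_+$ to an element $s_0s_1s_2\cdots\in S_\infty$, these products satisfying: $(st)x=s(tx)$; $s\,(s_0s_1\cdots)=s\,s_0s_1\cdots$; and the infinite product of a sequence is unchanged when consecutive finite blocks of the sequence are replaced by their products in $S_+$. It is finite if $S_+$ and $S_\infty$ are finite. With concatenation, $(A^+,A^\infty)$ is an $\omega$-semigroup. A morphism of $\omega$-semigroups is a pair of maps, one on each component, that commutes with the three products. A subset of $A^+$ (respectively $A^\infty$) is FO-definable if it is the set of words in $A^+$ (respectively $A^\infty$) that satisfy some first-order sentence over the positions of the word, in the signature consisting of the order $<$ and one unary predicate $a(x)$ for each $a\in A$. Let $X$ be $A^+$ or $A^\infty$. An FO-partition of $X$ is a finite partition of $X$ into FO-definable sets. For a map $\beta:X\to Y$ into a finite set and an FO-partition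 $\mathbf K$ of $X$, the imprint of $\mathbf K$ on $\beta$ is \[\mathcal I[\beta](\mathbf K)=\{T\subseteq Y \mid T\subseteq\beta(K)\text{ for some }K\in\mathbf K\}.\] An FO-partition $\mathbf K$ is optimal for $\beta$ if $\mathcal I[\beta](\mathbf K)\subseteq\mathcal I[\beta](\mathbf K')$ for every FO-partition $\mathbf K'$ of $X$. Optimal FO-partitions exist, and all of them have the same imprint on $\beta$; it is called the optimal imprint and denoted by $\mathcal I[\beta]$. Given an $\omega$-semigroup $(S_+,S_\infty)$, put $T^\infty=\{s_0s_1s_2\cdots\mid s_i\in T\text{ for all }i\}$ and $TU=\{sx\mid s\in T,\ x\in U\}$ for $T\subseteq S_+$ and $U\subseteq S_\infty$. For $\mathcal S\subseteq 2^{S_+}$, let $\mathrm{Sat}_\infty(\mathcal S)$ be the smallest subset $\mathcal U$ of $2^{S_\infty}$ such that 1. $T^\infty\in\mathcal U$ for every $T\in\mathcal S$; 2. $TU\in\mathcal U$ for every $T\in\mathcal S$ and $U\in\mathcal U$; 3. if $U\in\mathcal U$ and $V\subseteq U$, then $V\in\mathcal U$. **Proposition.** Let $\alpha:(A^+,A^\infty)\to(S_+,S_\infty)$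 be a morphism into a finite $\omega$-semigroup, with components $\alpha_+:A^+\to S_+$ and $\alpha_\infty:A^\infty\to S_\infty$. Then \[\mathcal I[\alpha_\infty]=\mathrm{Sat}_\infty(\mathcal I[\alpha_+]).\] -/

import Mathlib

universe u v w z

namespace FOImprint

/-! ### Omega-semigroups -/

/-- `segProd f i m` is the product `f i * f (i + 1) * ⋯ * f (i + m)` of `m + 1` consecutive terms. -/
def segProd {S : Type u} [Semigroup S] (f : ℕ → S) (i : ℕ) : ℕ → S
  | 0 => f i
  | m + 1 => segProd f i m * f (i + (m + 1))

/-- The sequence `s, f 0, f 1, …`. -/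
def seqCons {S : Type u} (s : S) (f : ℕ → S) : ℕ → S
  | 0 => s
  | n + 1 => f n

/-- An omega-semigroup `(S, T)`: a semigroup `S`, a set `T`, a mixed product `S × T → T` and an
infinite product from sequences of elements of `S` to `T`, subject to all forms of associativity.
In the last axiom, the sequence `f` is cut into the consecutive finite blocks
`f (k n), …, f (k (n + 1) - 1)`, for `0 = k 0 < k 1 < k 2 < ⋯`. -/
class OmegaSemigroup (S : Type u) (T : Type v) [Semigroup S] where
  mixed : S → T → T
  infProd : (ℕ → S) → T
  mul_mixed : ∀ (s t : S) (x : T), mixed (s * t) x = mixed s (mixed t x)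
  mixed_infProd : ∀ (s : S) (f : ℕ → S), mixed s (infProd f) = infProd (seqCons s f)
  infProd_blocks : ∀ (f : ℕ → S) (k : ℕ → ℕ), StrictMono k → k 0 = 0 →
    infProd (fun n => segProd f (k n) (k (n + 1) - k n - 1)) = infProd f

/-- Morphisms of omega-semigroups `(S, T) → (S', T')`. -/
structure OmegaHom (S : Type u) (T : Type v) (S' : Type w) (T' : Type z)
    [Semigroup S] [OmegaSemigroup S T] [Semigroup S'] [OmegaSemigroup S' T'] where
  /-- the component on finite words, a semigroup morphism -/
  fin : S →ₙ* S'
  /-- the component on infinite words -/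
  inf : T → T'
  map_mixed : ∀ (s : S) (x : T),
    inf (OmegaSemigroup.mixed s x) = OmegaSemigroup.mixed (fin s) (inf x)
  map_infProd : ∀ f : ℕ → S,
    inf (OmegaSemigroup.infProd f) = OmegaSemigroup.infProd (fun n => fin (f n))

/-! ### Finite and infinite words -/

/-- Nonempty finite words over `A`. -/
abbrev Word (A : Type u) : Type u := FreeSemigroup A

/-- Infinite words over `A`. -/
abbrev OmegaWord (A : Type u) : Type u := ℕ → A

/-- The list of letters of a nonempty finite word. -/
def letters {A : Type u} (w : Word A) : List A := w.head :: w.tail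

/-- The letter at a position of a nonempty finite word. -/
def letterAt {A : Type u} (w : Word A) (p : Fin (letters w).length) : A := (letters w).get p

theorem letters_mul {A : Type u} (v w : Word A) : letters (v * w) = letters v ++ letters w := rfl

theorem letters_length_pos {A : Type u} (w : Word A) : 0 < (letters w).length :=
  Nat.succ_pos _

theorem lt_length_segProd {A : Type u} (f : ℕ → Word A) (i m : ℕ) :
    m < (letters (segProd f i m)).length := by
  induction m with
  | zero => exact letters_length_pos _
  | succ m ih =>
    have h := letters_length_pos (f (i + (m + 1)))
    simp only [segProd, letters_mul, List.length_append]
    omega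

/-- The concatenation of a finite word and an infinite word. -/
def concat {A : Type u} (w : Word A) (x : OmegaWord A) : OmegaWord A := fun p =>
  if h : p < (letters w).length then (letters w)[p] else x (p - (letters w).length)

/-- The infinite concatenation `f 0 · f 1 · f 2 ⋯` of nonempty finite words: its letter at position
`p` is the letter at position `p` of `f 0 ⋯ f p`, a word of length greater than `p`. -/
def infConcat {A : Type u} (f : ℕ → Word A) : OmegaWord A := fun p =>
  (letters (segProd f 0 p))[p]'(lt_length_segProd f 0 p)

theorem segProd_prefix {A : Type u} (f : ℕ → Word A) (i : ℕ) {m n : ℕ} (h : m ≤ n) :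
    letters (segProd f i m) <+: letters (segProd f i n) := by
  induction n, h using Nat.le_induction with
  | base => exact List.prefix_rfl
  | succ n _ ih => exact ih.trans (List.prefix_append _ _)

theorem infConcat_eq {A : Type u} (f : ℕ → Word A) (p q : ℕ)
    (h : p < (letters (segProd f 0 q)).length) :
    infConcat f p = (letters (segProd f 0 q))[p] := by
  rcases le_total p q with hpq | hpq
  · exact (segProd_prefix f 0 hpq).getElem _
  · exact ((segProd_prefix f 0 hpq).getElem h).symm

theorem segProd_mul {S : Type u} [Semigroup S] (f : ℕ → S) (i m n : ℕ) :
    segProd f i m * segProd f (i + m + 1) n = segProd f i (m + n + 1) := by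
  induction n with
  | zero => rfl
  | succ n ih =>
    have e : i + m + 1 + (n + 1) = i + (m + (n + 1) + 1) := by omega
    simp only [segProd]
    rw [← mul_assoc, ih, e]
    rfl

theorem segProd_cons {S : Type u} [Semigroup S] (s : S) (f : ℕ → S) (m : ℕ) :
    segProd (seqCons s f) 0 (m + 1) = s * segProd f 0 m := by
  induction m with
  | zero => rfl
  | succ m ih =>
    rw [segProd, ih, segProd, ← mul_assoc]
    simp [seqCons]

theorem segProd_blocks {S : Type u} [Semigroup S] (f : ℕ → S) (k : ℕ → ℕ) (hk : StrictMono k)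
    (h0 : k 0 = 0) (m : ℕ) :
    segProd (fun n => segProd f (k n) (k (n + 1) - k n - 1)) 0 m
      = segProd f 0 (k (m + 1) - 1) := by
  induction m with
  | zero => simp [segProd, h0]
  | succ m ih =>
    have h1 : k (m + 1) < k (m + 1 + 1) := hk (Nat.lt_succ_self _)
    have h2 : 0 < k (m + 1) := by rw [← h0]; exact hk (Nat.succ_pos _)
    rw [segProd, ih]
    have h3 := segProd_mul f 0 (k (m + 1) - 1) (k (m + 1 + 1) - k (m + 1) - 1)
    have e1 : 0 + (k (m + 1) - 1) + 1 = k (m + 1) := by omega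
    have e2 : k (m + 1) - 1 + (k (m + 1 + 1) - k (m + 1) - 1) + 1 = k (m + 1 + 1) - 1 := by omega
    rw [e1, e2] at h3
    simpa using h3

/-- The omega-semigroup of nonempty finite words and infinite words over `A`. -/
instance instOmegaSemigroupWord (A : Type u) : OmegaSemigroup (Word A) (OmegaWord A) where
  mixed := concat
  infProd := infConcat
  mul_mixed v w x := by
    funext p
    simp only [concat, letters_mul, List.length_append, List.getElem_append]
    by_cases h1 : p < (letters v).length
    · simp [h1, Nat.lt_add_right]
    · by_cases h2 : p - (letters v).length < (letters w).length
      · have h3 : p < (letters v).length + (letters w).length := by omega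
        simp [h1, h2, h3]
      · have h3 : ¬ p < (letters v).length + (letters w).length := by omega
        simp [h1, h2, h3, Nat.sub_sub]
  mixed_infProd w f := by
    funext p
    have hl : p < (letters w ++ letters (segProd f 0 p)).length := by
      have := lt_length_segProd f 0 p
      rw [List.length_append]; omega
    have e : letters (segProd (seqCons w f) 0 (p + 1)) = letters w ++ letters (segProd f 0 p) := by
      rw [segProd_cons, letters_mul]
    rw [infConcat_eq (seqCons w f) p (p + 1) (by rw [e]; exact hl)]
    simp only [e, concat, List.getElem_append]
    by_cases h1 : p < (letters w).length
    · simp [h1]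
    · simp only [h1, dite_false]
      exact infConcat_eq f _ _ _
  infProd_blocks f k hk h0 := by
    funext p
    have e := segProd_blocks f k hk h0 p
    have hl := lt_length_segProd (fun n => segProd f (k n) (k (n + 1) - k n - 1)) 0 p
    rw [infConcat_eq f p (k (p + 1) - 1) (by rw [← e]; exact hl)]
    simp only [infConcat, e]

/-! ### First-order logic over words -/

/-- The relation symbols of `FO(<)` over `A`: a unary one for each letter, and a binary one. -/
inductive WordRel (A : Type u) : ℕ → Type u
  | letter (a : A) : WordRel A 1
  | lt : WordRel A 2

/-- The first-order signature of words over `A`. -/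
def wordLang (A : Type u) : FirstOrder.Language.{0, u} where
  Functions _ := Empty
  Relations := WordRel A

/-- The logical structure of a word with ordered set of positions `P` and labelling `ℓ`. -/
abbrev wordStructure {A : Type u} {P : Type} [LT P] (ℓ : P → A) : (wordLang A).Structure P where
  funMap := fun f => Empty.elim f
  RelMap := fun r x => match r, x with
    | WordRel.letter a, x => ℓ (x 0) = a
    | WordRel.lt, x => x 0 < x 1

/-- The word with labelling `ℓ` satisfies the sentence `φ` of `FO(<)`. -/
def Satisfies {A : Type u} {P : Type} [LT P] (ℓ : P → A) (φ : (wordLang A).Sentence) : Prop :=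
  letI := wordStructure ℓ
  φ.Realize P

/-- The first-order definable languages of nonempty finite words. -/
def foWord (A : Type u) : Set (Set (Word A)) :=
  {L | ∃ φ : (wordLang A).Sentence, L = {w | Satisfies (letterAt w) φ}}

/-- The first-order definable languages of infinite words. -/
def foOmega (A : Type u) : Set (Set (OmegaWord A)) :=
  {L | ∃ φ : (wordLang A).Sentence, L = {x | Satisfies x φ}}

/-! ### Partitions, imprints and optimal imprints

Here `X` is the set of all words under consideration, `C` a class of subsets of `X` and `α` a map
from `X` to `Y`. -/

/-- `K` is a finite partition of `X` into languages of `C`. -/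
def IsClassPartition {X : Type u} (C : Set (Set X)) (K : Set (Set X)) : Prop :=
  K.Finite ∧ Setoid.IsPartition K ∧ K ⊆ C

/-- The imprint of `K` on `α`. -/
def imprint {X : Type u} {Y : Type v} (α : X → Y) (K : Set (Set X)) : Set (Set Y) :=
  {T | ∃ L ∈ K, T ⊆ α '' L}

/-- `K` is an optimal `C`-partition for `α`. -/
def IsOptimal {X : Type u} {Y : Type v} (C : Set (Set X)) (α : X → Y) (K : Set (Set X)) : Prop :=
  IsClassPartition C K ∧ ∀ K', IsClassPartition C K' → imprint α K ⊆ imprint α K'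

/-- The optimal imprint with respect to `C` on `α`, that is, the imprint on `α` of any optimal
`C`-partition for `α`. -/
def optimalImprint {X : Type u} {Y : Type v} (C : Set (Set X)) (α : X → Y) : Set (Set Y) :=
  {T | ∃ K, IsOptimal C α K ∧ T ∈ imprint α K}

theorem optimalImprint_eq {X : Type u} {Y : Type v} {C : Set (Set X)} {α : X → Y} {K : Set (Set X)}
    (hK : IsOptimal C α K) : optimalImprint C α = imprint α K := by
  ext T
  constructor
  · rintro ⟨K', hK', hT⟩
    exact hK'.2 K hK.1 hT
  · exact fun hT => ⟨K, hK, hT⟩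

theorem exists_isOptimal {X : Type u} {Y : Type v} [Finite Y] {C : Set (Set X)}
    (huniv : Set.univ ∈ C) (hinter : ∀ L ∈ C, ∀ L' ∈ C, L ∩ L' ∈ C) (α : X → Y) :
    ∃ K, IsOptimal C α K := by
  have hne : {I | ∃ K, IsClassPartition C K ∧ I = imprint α K}.Nonempty := by
    rcases isEmpty_or_nonempty X with hX | hX
    · exact ⟨_, ∅, ⟨Set.finite_empty, ⟨Set.notMem_empty _, fun a => hX.elim a⟩,
        Set.empty_subset _⟩, rfl⟩
    · refine ⟨_, {Set.univ}, ⟨Set.finite_singleton _, ⟨?_, fun a => ?_⟩, ?_⟩, rfl⟩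
      · simpa using (Set.univ_nonempty.ne_empty (α := X)).symm
      · exact ⟨Set.univ, ⟨rfl, trivial⟩, fun L hL => hL.1⟩
      · simpa using huniv
  obtain ⟨I, hI⟩ := (Set.toFinite {I | ∃ K, IsClassPartition C K ∧ I = imprint α K}).exists_minimal
    hne
  obtain ⟨K, hK, rfl⟩ := hI.1
  refine ⟨K, hK, fun K' hK' => ?_⟩
  have hM : IsClassPartition C {L | L.Nonempty ∧ ∃ L₁ ∈ K, ∃ L₂ ∈ K', L = L₁ ∩ L₂} := by
    refine ⟨?_, ⟨fun h => by simpa using h.1, fun a => ?_⟩, ?_⟩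
    · refine (hK.1.image2 (fun L₁ L₂ => L₁ ∩ L₂) hK'.1).subset ?_
      rintro L ⟨-, L₁, h₁, L₂, h₂, rfl⟩
      exact ⟨L₁, h₁, L₂, h₂, rfl⟩
    · obtain ⟨L₁, ⟨h₁, a₁⟩, u₁⟩ := hK.2.1.2 a
      obtain ⟨L₂, ⟨h₂, a₂⟩, u₂⟩ := hK'.2.1.2 a
      refine ⟨L₁ ∩ L₂, ⟨⟨⟨a, a₁, a₂⟩, L₁, h₁, L₂, h₂, rfl⟩, a₁, a₂⟩, ?_⟩
      rintro L ⟨⟨-, M₁, m₁, M₂, m₂, rfl⟩, b₁, b₂⟩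
      rw [u₁ M₁ ⟨m₁, b₁⟩, u₂ M₂ ⟨m₂, b₂⟩]
    · rintro L ⟨-, L₁, h₁, L₂, h₂, rfl⟩
      exact hinter _ (hK.2.2 h₁) _ (hK'.2.2 h₂)
  have hle : imprint α {L | L.Nonempty ∧ ∃ L₁ ∈ K, ∃ L₂ ∈ K', L = L₁ ∩ L₂} ⊆ imprint α K := by
    rintro T ⟨L, ⟨-, L₁, h₁, L₂, h₂, rfl⟩, hT⟩
    exact ⟨L₁, h₁, hT.trans (Set.image_mono Set.inter_subset_left)⟩
  intro T hT
  obtain ⟨L, ⟨-, L₁, h₁, L₂, h₂, rfl⟩, hT'⟩ := hI.2 ⟨_, hM, rfl⟩ hle hT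
  exact ⟨L₂, h₂, hT'.trans (Set.image_mono Set.inter_subset_right)⟩

/-- First-order optimal partitions of finite words exist. -/
theorem exists_isOptimal_foWord {A : Type u} {Y : Type v} [Finite Y] (α : Word A → Y) :
    ∃ K, IsOptimal (foWord A) α K := by
  have huniv : Set.univ ∈ foWord A := by
    refine ⟨⊤, ?_⟩
    ext w
    simp [Satisfies, FirstOrder.Language.Sentence.Realize]
  refine exists_isOptimal huniv ?_ α
  rintro _ ⟨φ, rfl⟩ _ ⟨ψ, rfl⟩
  refine ⟨φ ⊓ ψ, ?_⟩
  ext w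
  simp [Satisfies, FirstOrder.Language.Sentence.Realize]

/-- First-order optimal partitions of infinite words exist. -/
theorem exists_isOptimal_foOmega {A : Type u} {Y : Type v} [Finite Y] (α : OmegaWord A → Y) :
    ∃ K, IsOptimal (foOmega A) α K := by
  have huniv : Set.univ ∈ foOmega A := by
    refine ⟨⊤, ?_⟩
    ext w
    simp [Satisfies, FirstOrder.Language.Sentence.Realize]
  refine exists_isOptimal huniv ?_ α
  rintro _ ⟨φ, rfl⟩ _ ⟨ψ, rfl⟩
  refine ⟨φ ⊓ ψ, ?_⟩
  ext w
  simp [Satisfies, FirstOrder.Language.Sentence.Realize]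

/-! ### Saturation -/

/-- The mixed product of subsets: all `s x` with `s ∈ R` and `x ∈ U`. -/
def setMixed {S : Type u} {T : Type v} [Semigroup S] [OmegaSemigroup S T] (R : Set S) (U : Set T) :
    Set T :=
  {y | ∃ s ∈ R, ∃ x ∈ U, y = OmegaSemigroup.mixed s x}

/-- The infinite power of a subset `R` of `S`: all `s₀ s₁ s₂ ⋯` where each `sₙ` is in `R`. -/
def setInfPow {S : Type u} (T : Type v) [Semigroup S] [OmegaSemigroup S T] (R : Set S) : Set T :=
  {y | ∃ f : ℕ → S, (∀ n, f n ∈ R) ∧ y = OmegaSemigroup.infProd f}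

/-- `𝒰` contains the infinite powers of the members of `𝒮`, is closed under left multiplication by
members of `𝒮`, and is closed under downset. -/
def IsSaturated {S : Type u} {T : Type v} [Semigroup S] [OmegaSemigroup S T] (𝒮 : Set (Set S))
    (𝒰 : Set (Set T)) : Prop :=
  (∀ R ∈ 𝒮, setInfPow T R ∈ 𝒰) ∧
  (∀ R ∈ 𝒮, ∀ U ∈ 𝒰, setMixed R U ∈ 𝒰) ∧
  (∀ U ∈ 𝒰, ∀ V, V ⊆ U → V ∈ 𝒰)

/-- The smallest saturated subset of `Set T`. -/
def satInf {S : Type u} (T : Type v) [Semigroup S] [OmegaSemigroup S T] (𝒮 : Set (Set S)) :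
    Set (Set T) :=
  ⋂₀ {𝒰 | IsSaturated 𝒮 𝒰}

theorem satInf_isLeast {S : Type u} (T : Type v) [Semigroup S] [OmegaSemigroup S T]
    (𝒮 : Set (Set S)) : IsLeast {𝒰 | IsSaturated 𝒮 𝒰} (satInf T 𝒮) := by
  refine ⟨⟨fun R hR 𝒰 h => h.1 R hR, fun R hR U hU 𝒰 h => h.2.1 R hR U (hU 𝒰 h),
    fun U hU V hV 𝒰 h => h.2.2 U (hU 𝒰 h) V hV⟩, fun 𝒰 h => Set.sInter_subset_of_mem h⟩

end FOImprint

/-! First-order definability is replaced by rank-`k` Ehrenfeucht–Fraïssé equivalence. Each rank has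
finitely many classes, all definable, and every first-order partition is refined by the classes of
some rank. Hence a set lies in an optimal imprint iff, for every `k`, it is covered by the image of
a single rank-`k` class (`mem_optimalImprint_foOmega_iff`).

The imprint on infinite words is saturated because rank-`k` equivalence is a congruence for the
mixed and the infinite product (`BackForth.concat`, `BackForth.infConcat`, both from
`BackForth.sum`). This gives one inclusion.

For the other, fix `k` such that images of rank-`k` classes of finite words lie in the imprint of
`α.fin`. By a Ramsey argument an infinite word `x` factors, up to rank `k`, as `u v v v ⋯`. The same
`u`, `v` must serve all words equivalent to `x` at some higher rank, but an infinite set of cut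
points cannot be quantified in first-order logic. `Factorizes` instead asks for one position `a` and
arbitrarily late `c` that merge with `a`: the factors from `a` and from `c` to some common `d` are
equivalent. This survives passage to a word equivalent at rank `k + 5` (`Factorizes.of_backForth`),
and since merged positions stay merged, it yields the cut points one at a time
(`Factorizes.exists_seq`). So all values on the class of `x` lie in one set `R Q^∞`, with `R`, `Q`
the images of the classes of `u`, `v`. -/

namespace FOImprint

open Set

/-! ### Back-and-forth equivalence of labelled orders -/

section BackForth

variable {A : Type u} {P P' P'' : Type}

/-- The pairs of `R` have the same labels and are ordered in the same way. -/
def AtomEquiv [LT P] [LT P'] (ℓ : P → A) (ℓ' : P' → A) (R : Set (P × P')) : Prop :=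
  (∀ a ∈ R, ℓ a.1 = ℓ' a.2) ∧ ∀ a ∈ R, ∀ b ∈ R, (a.1 < b.1 ↔ a.2 < b.2)

/-- Duplicator wins the `k`-round Ehrenfeucht–Fraïssé game between two words, from the position in
which the pairs of `R` have been chosen. -/
def BackForth [LT P] [LT P'] (ℓ : P → A) (ℓ' : P' → A) : ℕ → Set (P × P') → Prop
  | 0, R => AtomEquiv ℓ ℓ' R
  | k + 1, R => AtomEquiv ℓ ℓ' R ∧ (∀ p, ∃ p', BackForth ℓ ℓ' k (insert (p, p') R)) ∧
      ∀ p', ∃ p, BackForth ℓ ℓ' k (insert (p, p') R)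

section Basic

variable [LT P] [LT P'] [LT P''] {ℓ : P → A} {ℓ' : P' → A} {ℓ'' : P'' → A}

theorem AtomEquiv.mono {R R' : Set (P × P')} (h : AtomEquiv ℓ ℓ' R') (hR : R ⊆ R') :
    AtomEquiv ℓ ℓ' R :=
  ⟨fun a ha => h.1 a (hR ha), fun a ha b hb => h.2 a (hR ha) b (hR hb)⟩

theorem BackForth.atomEquiv {k : ℕ} {R : Set (P × P')} (h : BackForth ℓ ℓ' k R) :
    AtomEquiv ℓ ℓ' R := by
  cases k with
  | zero => exact h
  | succ k => exact h.1

/-- Fewer chosen pairs constrain Duplicator less. Later constructions produce sets of pairs only up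
to inclusion, and this absorbs the difference. -/
theorem BackForth.mono {k : ℕ} {R R' : Set (P × P')} (h : BackForth ℓ ℓ' k R') (hR : R ⊆ R') :
    BackForth ℓ ℓ' k R := by
  induction k generalizing R R' with
  | zero => exact AtomEquiv.mono h hR
  | succ k ih =>
    refine ⟨h.1.mono hR, fun p => ?_, fun p' => ?_⟩
    · obtain ⟨p', hp⟩ := h.2.1 p
      exact ⟨p', ih hp (insert_subset_insert hR)⟩
    · obtain ⟨p, hp⟩ := h.2.2 p'
      exact ⟨p, ih hp (insert_subset_insert hR)⟩

theorem BackForth.of_succ {k : ℕ} {R : Set (P × P')} (h : BackForth ℓ ℓ' (k + 1) R) :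
    BackForth ℓ ℓ' k R := by
  induction k generalizing R with
  | zero => exact h.1
  | succ k ih =>
    exact ⟨h.1, fun p => (h.2.1 p).imp fun _ hp => ih hp, fun p' => (h.2.2 p').imp fun _ hp => ih hp⟩

theorem BackForth.of_le {k m : ℕ} {R : Set (P × P')} (hkm : k ≤ m) (h : BackForth ℓ ℓ' m R) :
    BackForth ℓ ℓ' k R := by
  induction m, hkm using Nat.le_induction with
  | base => exact h
  | succ m _ ih => exact ih h.of_succ

theorem BackForth.symm {k : ℕ} {R : Set (P × P')} (h : BackForth ℓ ℓ' k R) :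
    BackForth ℓ' ℓ k (Prod.swap ⁻¹' R) := by
  have hatom : ∀ {R : Set (P × P')}, AtomEquiv ℓ ℓ' R → AtomEquiv ℓ' ℓ (Prod.swap ⁻¹' R) :=
    fun h => ⟨fun a ha => (h.1 _ ha).symm, fun a ha b hb => (h.2 _ ha _ hb).symm⟩
  have hins : ∀ (p : P) (p' : P') (R : Set (P × P')),
      insert (p', p) (Prod.swap ⁻¹' R) ⊆ Prod.swap ⁻¹' (insert (p, p') R) := by
    rintro p p' R _ (rfl | ha)
    · exact Or.inl rfl
    · exact Or.inr ha
  induction k generalizing R with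
  | zero => exact hatom h
  | succ k ih =>
    exact ⟨hatom h.1, fun p' => (h.2.2 p').imp fun p hp => (ih hp).mono (hins _ _ _),
      fun p => (h.2.1 p).imp fun p' hp => (ih hp).mono (hins _ _ _)⟩

/-- Duplicator answers through the middle order, composing the two strategies. -/
theorem BackForth.trans {k : ℕ} {R : Set (P × P')} {R' : Set (P' × P'')}
    (h : BackForth ℓ ℓ' k R) (h' : BackForth ℓ' ℓ'' k R') :
    BackForth ℓ ℓ'' k {a | ∃ p', (a.1, p') ∈ R ∧ (p', a.2) ∈ R'} := by
  have hatom : ∀ {R : Set (P × P')} {R' : Set (P' × P'')}, AtomEquiv ℓ ℓ' R →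
      AtomEquiv ℓ' ℓ'' R' → AtomEquiv ℓ ℓ'' {a | ∃ p', (a.1, p') ∈ R ∧ (p', a.2) ∈ R'} := by
    intro R R' h h'
    refine ⟨?_, ?_⟩
    · rintro a ⟨p, h₁, h₂⟩
      exact (h.1 _ h₁).trans (h'.1 _ h₂)
    · rintro a ⟨p, h₁, h₂⟩ b ⟨q, h₃, h₄⟩
      exact (h.2 _ h₁ _ h₃).trans (h'.2 _ h₂ _ h₄)
  have hins : ∀ (p : P) (p' : P') (p'' : P'') (R : Set (P × P')) (R' : Set (P' × P'')),
      insert (p, p'') {a : P × P'' | ∃ p', (a.1, p') ∈ R ∧ (p', a.2) ∈ R'} ⊆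
        {a | ∃ q, (a.1, q) ∈ insert (p, p') R ∧ (q, a.2) ∈ insert (p', p'') R'} := by
    rintro p p' p'' R R' _ (rfl | ⟨q, h₁, h₂⟩)
    · exact ⟨p', Or.inl rfl, Or.inl rfl⟩
    · exact ⟨q, Or.inr h₁, Or.inr h₂⟩
  induction k generalizing R R' with
  | zero => exact hatom h h'
  | succ k ih =>
    refine ⟨hatom h.1 h'.1, fun p => ?_, fun p'' => ?_⟩
    · obtain ⟨p', hp⟩ := h.2.1 p
      obtain ⟨p'', hp'⟩ := h'.2.1 p'
      exact ⟨p'', (ih hp hp').mono (hins _ _ _ _ _)⟩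
    · obtain ⟨p', hp'⟩ := h'.2.2 p''
      obtain ⟨p, hp⟩ := h.2.2 p'
      exact ⟨p, (ih hp hp').mono (hins _ _ _ _ _)⟩

end Basic

/-- Back-and-forth equivalence restricts to parts that are cut out by chosen positions. -/
theorem BackForth.restrict {Q Q' : Type} [LinearOrder P] [LinearOrder P'] [LinearOrder Q]
    [LinearOrder Q'] {ℓ : P → A} {ℓ' : P' → A} {g : Q → P} {g' : Q' → P'} (hg : StrictMono g)
    (hg' : StrictMono g') {k : ℕ} {R₀ R : Set (P × P')}
    (hrange : ∀ p p', AtomEquiv ℓ ℓ' (insert (p, p') R₀) → (p ∈ range g ↔ p' ∈ range g'))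
    (hR : R₀ ⊆ R) (h : BackForth ℓ ℓ' k R) :
    BackForth (ℓ ∘ g) (ℓ' ∘ g') k {a | (g a.1, g' a.2) ∈ R} := by
  have hatom : ∀ {R : Set (P × P')}, AtomEquiv ℓ ℓ' R →
      AtomEquiv (ℓ ∘ g) (ℓ' ∘ g') {a | (g a.1, g' a.2) ∈ R} := fun h =>
    ⟨fun a ha => h.1 _ ha, fun a ha b hb =>
      hg.lt_iff_lt.symm.trans ((h.2 _ ha _ hb).trans hg'.lt_iff_lt)⟩
  have hins : ∀ (q : Q) (q' : Q') (R : Set (P × P')),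
      insert (q, q') {a : Q × Q' | (g a.1, g' a.2) ∈ R} ⊆
        {a | (g a.1, g' a.2) ∈ insert (g q, g' q') R} := by
    rintro q q' R _ (rfl | ha)
    · exact Or.inl rfl
    · exact Or.inr ha
  induction k generalizing R with
  | zero => exact hatom h
  | succ k ih =>
    refine ⟨hatom h.1, fun q => ?_, fun q' => ?_⟩
    · obtain ⟨p', hp⟩ := h.2.1 (g q)
      -- The pairs in `R₀` force the reply to a move inside the part to stay inside the
      -- corresponding part.
      obtain ⟨q', rfl⟩ :=
        (hrange _ _ (hp.atomEquiv.mono (insert_subset_insert hR))).1 (mem_range_self q)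
      exact ⟨q', (ih (hR.trans (subset_insert _ _)) hp).mono (hins _ _ _)⟩
    · obtain ⟨p, hp⟩ := h.2.2 (g' q')
      obtain ⟨q, rfl⟩ :=
        (hrange _ _ (hp.atomEquiv.mono (insert_subset_insert hR))).2 (mem_range_self q')
      exact ⟨q, (ih (hR.trans (subset_insert _ _)) hp).mono (hins _ _ _)⟩

/-- Back-and-forth equivalence is compatible with lexicographic sums. -/
theorem BackForth.sum {ι : Type} [LinearOrder ι] {Q Q' : ι → Type} [∀ i, LinearOrder (Q i)]
    [∀ i, LinearOrder (Q' i)] [LinearOrder P] [LinearOrder P'] {ℓ : P → A} {ℓ' : P' → A}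
    {m : ∀ i, Q i → A} {m' : ∀ i, Q' i → A} {g : ∀ i, Q i → P} {g' : ∀ i, Q' i → P'}
    (hg : ∀ i, StrictMono (g i)) (hg' : ∀ i, StrictMono (g' i))
    (hlt : ∀ i j, i < j → ∀ q r, g i q < g j r) (hlt' : ∀ i j, i < j → ∀ q r, g' i q < g' j r)
    (hsurj : ∀ p, ∃ i q, g i q = p) (hsurj' : ∀ p, ∃ i q, g' i q = p)
    (hm : ∀ i q, ℓ (g i q) = m i q) (hm' : ∀ i q, ℓ' (g' i q) = m' i q)
    {k : ℕ} {R : ∀ i, Set (Q i × Q' i)} (h : ∀ i, BackForth (m i) (m' i) k (R i)) :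
    BackForth ℓ ℓ' k {a | ∃ i, ∃ b ∈ R i, a = (g i b.1, g' i b.2)} := by
  classical
  have hatom : ∀ {R : ∀ i, Set (Q i × Q' i)}, (∀ i, AtomEquiv (m i) (m' i) (R i)) →
      AtomEquiv ℓ ℓ' {a | ∃ i, ∃ b ∈ R i, a = (g i b.1, g' i b.2)} := by
    intro R h
    refine ⟨?_, ?_⟩
    · rintro _ ⟨i, b, hb, rfl⟩
      simpa only [hm, hm'] using (h i).1 b hb
    · rintro _ ⟨i, b, hb, rfl⟩ _ ⟨j, c, hc, rfl⟩
      rcases lt_trichotomy i j with hij | rfl | hij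
      · exact iff_of_true (hlt _ _ hij _ _) (hlt' _ _ hij _ _)
      · exact (hg i).lt_iff_lt.trans (((h i).2 b hb c hc).trans (hg' i).lt_iff_lt.symm)
      · exact iff_of_false (hlt _ _ hij _ _).not_gt (hlt' _ _ hij _ _).not_gt
  have hins : ∀ (i : ι) (q : Q i) (q' : Q' i) (R : ∀ i, Set (Q i × Q' i)),
      insert (g i q, g' i q') {a : P × P' | ∃ i, ∃ b ∈ R i, a = (g i b.1, g' i b.2)} ⊆
        {a | ∃ j, ∃ b ∈ Function.update R i (insert (q, q') (R i)) j,
          a = (g j b.1, g' j b.2)} := by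
    rintro i q q' R _ (rfl | ⟨j, b, hb, rfl⟩)
    · exact ⟨i, (q, q'), by simp, rfl⟩
    · refine ⟨j, b, ?_, rfl⟩
      rcases eq_or_ne j i with rfl | hj
      · simpa using Or.inr hb
      · simpa [hj] using hb
  -- A round is played in one summand only; the other summands simply forgo one round.
  have hstep : ∀ (k : ℕ) (R : ∀ i, Set (Q i × Q' i)),
      (∀ i, BackForth (m i) (m' i) (k + 1) (R i)) → ∀ i q q',
      BackForth (m i) (m' i) k (insert (q, q') (R i)) →
      ∀ j, BackForth (m j) (m' j) k (Function.update R i (insert (q, q') (R i)) j) := by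
    intro k R h i q q' hi j
    rcases eq_or_ne j i with rfl | hj
    · simpa using hi
    · simpa [hj] using (h j).of_succ
  induction k generalizing R with
  | zero => exact hatom h
  | succ k ih =>
    refine ⟨hatom fun i => (h i).1, fun p => ?_, fun p' => ?_⟩
    · obtain ⟨i, q, rfl⟩ := hsurj p
      obtain ⟨q', hq⟩ := (h i).2.1 q
      exact ⟨g' i q', (ih (hstep k R h i q q' hq)).mono (hins _ _ _ _)⟩
    · obtain ⟨i, q', rfl⟩ := hsurj' p'
      obtain ⟨q, hq⟩ := (h i).2.2 q'
      exact ⟨g i q, (ih (hstep k R h i q q' hq)).mono (hins _ _ _ _)⟩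

end BackForth

/-! ### First-order formulas and the back-and-forth equivalence -/

section Formulas

open FirstOrder

variable {A : Type u}

theorem range_snoc_pair {P P' : Type} {n : ℕ} (x : Fin n → P) (x' : Fin n → P') (p : P) (p' : P') :
    range (fun i => ((Fin.snoc x p : Fin (n + 1) → P) i, (Fin.snoc x' p' : Fin (n + 1) → P') i)) =
      insert (p, p') (range fun i => (x i, x' i)) := by
  ext a
  simp only [mem_range, mem_insert_iff, Fin.exists_fin_succ', Fin.snoc_castSucc, Fin.snoc_last]
  rw [or_comm, eq_comm (a := a)]

/-- The formula of `FO(<)` with free variables among `x₀, …, xₙ₋₁` holds at the positions `x`. -/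
def RealizeAt {P : Type} [LT P] {n : ℕ} (ℓ : P → A) (φ : (wordLang A).BoundedFormula Empty n)
    (x : Fin n → P) : Prop :=
  letI := wordStructure ℓ
  φ.Realize default x

theorem satisfies_iff_realizeAt {P : Type} [LT P] (ℓ : P → A) (φ : (wordLang A).Sentence) :
    Satisfies ℓ φ ↔ RealizeAt ℓ φ default := Iff.rfl

theorem term_eq_var {n : ℕ} (t : (wordLang A).Term (Empty ⊕ Fin n)) :
    ∃ i, t = Language.Term.var (Sum.inr i) := by
  cases t with
  | var a =>
    cases a with
    | inl e => exact e.elim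
    | inr i => exact ⟨i, rfl⟩
  | func f _ => exact Empty.elim f

/-- The truth of a formula is invariant under back-and-forth equivalence of some rank. -/
theorem exists_backForth_realizeAt {n : ℕ} (φ : (wordLang A).BoundedFormula Empty n) :
    ∃ k, ∀ (P P' : Type) [LinearOrder P] [LinearOrder P'] (ℓ : P → A) (ℓ' : P' → A)
      (x : Fin n → P) (x' : Fin n → P'), BackForth ℓ ℓ' k (range fun i => (x i, x' i)) →
      (RealizeAt ℓ φ x ↔ RealizeAt ℓ' φ x') := by
  induction φ with
  | falsum => exact ⟨0, fun P P' _ _ ℓ ℓ' x x' _ => Iff.rfl⟩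
  | equal t₁ t₂ =>
    refine ⟨0, fun P P' _ _ ℓ ℓ' x x' h => ?_⟩
    obtain ⟨i, rfl⟩ := term_eq_var t₁
    obtain ⟨j, rfl⟩ := term_eq_var t₂
    change x i = x j ↔ x' i = x' j
    -- `AtomEquiv` does not mention equality; in a linear order it is the failure of both strict
    -- comparisons.
    have h₁ := h.2 _ ⟨i, rfl⟩ _ ⟨j, rfl⟩
    have h₂ := h.2 _ ⟨j, rfl⟩ _ ⟨i, rfl⟩
    simp only at h₁ h₂
    constructor
    · intro e
      exact le_antisymm (not_lt.1 (h₂.not.1 e.le.not_gt)) (not_lt.1 (h₁.not.1 e.ge.not_gt))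
    · intro e
      exact le_antisymm (not_lt.1 (h₂.not.2 e.le.not_gt)) (not_lt.1 (h₁.not.2 e.ge.not_gt))
  | rel r ts =>
    refine ⟨0, fun P P' _ _ ℓ ℓ' x x' h => ?_⟩
    cases r with
    | letter a =>
      obtain ⟨i, hi⟩ := term_eq_var (ts 0)
      have h₁ := h.1 _ ⟨i, rfl⟩
      simp only at h₁
      simp [RealizeAt, Language.BoundedFormula.Realize, Language.Structure.RelMap, hi, h₁]
    | lt =>
      obtain ⟨i, hi⟩ := term_eq_var (ts 0)
      obtain ⟨j, hj⟩ := term_eq_var (ts 1)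
      have h₁ := h.2 _ ⟨i, rfl⟩ _ ⟨j, rfl⟩
      simp only at h₁
      simp [RealizeAt, Language.BoundedFormula.Realize, Language.Structure.RelMap, hi, hj, h₁]
  | imp φ ψ ihφ ihψ =>
    obtain ⟨k, hk⟩ := ihφ
    obtain ⟨m, hm⟩ := ihψ
    refine ⟨max k m, fun P P' _ _ ℓ ℓ' x x' h => ?_⟩
    exact imp_congr (hk P P' ℓ ℓ' x x' (h.of_le (le_max_left _ _)))
      (hm P P' ℓ ℓ' x x' (h.of_le (le_max_right _ _)))
  | all φ ih =>
    obtain ⟨k, hk⟩ := ih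
    refine ⟨k + 1, fun P P' _ _ ℓ ℓ' x x' h => ?_⟩
    change (∀ p, RealizeAt ℓ φ (Fin.snoc x p)) ↔ ∀ p', RealizeAt ℓ' φ (Fin.snoc x' p')
    constructor
    · intro H p'
      obtain ⟨p, hp⟩ := h.2.2 p'
      rw [← range_snoc_pair] at hp
      exact (hk P P' ℓ ℓ' _ _ hp).1 (H p)
    · intro H p
      obtain ⟨p', hp⟩ := h.2.1 p
      rw [← range_snoc_pair] at hp
      exact (hk P P' ℓ ℓ' _ _ hp).2 (H p')

/-- Finitely many formulas determine the back-and-forth equivalence of rank `k`. -/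
theorem exists_formulas_backForth [Finite A] (k n : ℕ) :
    ∃ (ι : Type u) (_ : Finite ι) (φ : ι → (wordLang A).BoundedFormula Empty n),
      ∀ (P P' : Type) [LinearOrder P] [LinearOrder P'] (ℓ : P → A) (ℓ' : P' → A)
      (x : Fin n → P) (x' : Fin n → P'), (∀ i, RealizeAt ℓ (φ i) x ↔ RealizeAt ℓ' (φ i) x') →
      BackForth ℓ ℓ' k (range fun i => (x i, x' i)) := by
  have hatom : ∀ n : ℕ, ∃ (ι : Type u) (_ : Finite ι)
      (φ : ι → (wordLang A).BoundedFormula Empty n),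
      ∀ (P P' : Type) [LinearOrder P] [LinearOrder P'] (ℓ : P → A) (ℓ' : P' → A)
      (x : Fin n → P) (x' : Fin n → P'), (∀ i, RealizeAt ℓ (φ i) x ↔ RealizeAt ℓ' (φ i) x') →
      AtomEquiv ℓ ℓ' (range fun i => (x i, x' i)) := by
    intro n
    let v : Fin n → (wordLang A).Term (Empty ⊕ Fin n) := fun i => Language.Term.var (Sum.inr i)
    refine ⟨(Fin n × A) ⊕ (Fin n × Fin n), inferInstance,
      Sum.elim (fun a => Language.BoundedFormula.rel (WordRel.letter a.2) ![v a.1])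
        (fun a => Language.BoundedFormula.rel WordRel.lt ![v a.1, v a.2]), ?_⟩
    intro P P' _ _ ℓ ℓ' x x' h
    refine ⟨?_, ?_⟩
    · rintro _ ⟨i, rfl⟩
      have := (h (Sum.inl (i, ℓ (x i)))).1 rfl
      exact Eq.symm this
    · rintro _ ⟨i, rfl⟩ _ ⟨j, rfl⟩
      exact h (Sum.inr (i, j))
  induction k generalizing n with
  | zero => exact hatom n
  | succ k ih =>
    obtain ⟨ι, _, φ, hφ⟩ := hatom n
    obtain ⟨κ, _, ψ, hψ⟩ := ih (n + 1)
    classical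
    -- `χ s` says that the last variable realizes exactly the type `s` of rank `k`. The formulas `(χ
    -- s).ex` thus record which types one more position can realize, which is what Duplicator needs
    -- for a reply.
    let χ : Set κ → (wordLang A).BoundedFormula Empty (n + 1) := fun s =>
      Language.BoundedFormula.iInf fun i => if i ∈ s then ψ i else (ψ i).not
    have hχ : ∀ (P : Type) [LinearOrder P] (ℓ : P → A) (s : Set κ) (x : Fin n → P),
        RealizeAt ℓ (χ s).ex x ↔ ∃ p, ∀ i, i ∈ s ↔ RealizeAt ℓ (ψ i) (Fin.snoc x p) := by
      intro P _ ℓ s x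
      simp only [RealizeAt, χ, Language.BoundedFormula.realize_ex,
        Language.BoundedFormula.realize_iInf]
      refine exists_congr fun p => forall_congr' fun i => ?_
      by_cases hi : i ∈ s <;> simp [hi]
    refine ⟨ι ⊕ Set κ, inferInstance, Sum.elim φ fun s => (χ s).ex, ?_⟩
    intro P P' _ _ ℓ ℓ' x x' h
    refine ⟨hφ P P' ℓ ℓ' x x' fun i => h (Sum.inl i), fun p => ?_, fun p' => ?_⟩
    · obtain ⟨p', hp⟩ := (hχ P' ℓ' _ x').1 ((h (Sum.inr _)).1
        ((hχ P ℓ {i | RealizeAt ℓ (ψ i) (Fin.snoc x p)} x).2 ⟨p, fun i => Iff.rfl⟩))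
      refine ⟨p', ?_⟩
      rw [← range_snoc_pair]
      exact hψ P P' ℓ ℓ' _ _ hp
    · obtain ⟨p, hp⟩ := (hχ P ℓ _ x).1 ((h (Sum.inr _)).2
        ((hχ P' ℓ' {i | RealizeAt ℓ' (ψ i) (Fin.snoc x' p')} x').2 ⟨p', fun i => Iff.rfl⟩))
      refine ⟨p, ?_⟩
      rw [← range_snoc_pair]
      exact hψ P P' ℓ ℓ' _ _ fun i => (hp i).symm

end Formulas

/-! ### Sums of two labelled orders -/

section BinarySum

variable {A : Type u} {P P' Q₁ Q₁' Q₂ Q₂' : Type}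

theorem BackForth.sum_two [LinearOrder Q₁] [LinearOrder Q₁'] [LinearOrder Q₂] [LinearOrder Q₂']
    [LinearOrder P] [LinearOrder P'] {ℓ : P → A} {ℓ' : P' → A}
    {m₁ : Q₁ → A} {m₁' : Q₁' → A} {m₂ : Q₂ → A} {m₂' : Q₂' → A}
    (g₁ : Q₁ → P) (g₁' : Q₁' → P') (g₂ : Q₂ → P) (g₂' : Q₂' → P')
    (hg₁ : StrictMono g₁) (hg₁' : StrictMono g₁') (hg₂ : StrictMono g₂) (hg₂' : StrictMono g₂')
    (hlt : ∀ q r, g₁ q < g₂ r) (hlt' : ∀ q r, g₁' q < g₂' r)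
    (hsurj : ∀ p, (∃ q, g₁ q = p) ∨ ∃ q, g₂ q = p)
    (hsurj' : ∀ p, (∃ q, g₁' q = p) ∨ ∃ q, g₂' q = p)
    (hm₁ : ∀ q, ℓ (g₁ q) = m₁ q) (hm₁' : ∀ q, ℓ' (g₁' q) = m₁' q)
    (hm₂ : ∀ q, ℓ (g₂ q) = m₂ q) (hm₂' : ∀ q, ℓ' (g₂' q) = m₂' q)
    {k : ℕ} (h₁ : BackForth m₁ m₁' k ∅) (h₂ : BackForth m₂ m₂' k ∅) : BackForth ℓ ℓ' k ∅ := by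
  let _ : ∀ b : Bool, LinearOrder (cond b Q₂ Q₁) := fun b => by cases b <;> assumption
  let _ : ∀ b : Bool, LinearOrder (cond b Q₂' Q₁') := fun b => by cases b <;> assumption
  refine (BackForth.sum (ι := Bool) (Q := fun b => cond b Q₂ Q₁) (Q' := fun b => cond b Q₂' Q₁')
    (ℓ := ℓ) (ℓ' := ℓ') (m := fun b => match b with | false => m₁ | true => m₂)
    (m' := fun b => match b with | false => m₁' | true => m₂')
    (g := fun b => match b with | false => g₁ | true => g₂)
    (g' := fun b => match b with | false => g₁' | true => g₂')
    (R := fun _ => ∅) (k := k) ?_ ?_ ?_ ?_ ?_ ?_ ?_ ?_ ?_).mono (empty_subset _)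
  · rintro (_ | _)
    exacts [hg₁, hg₂]
  · rintro (_ | _)
    exacts [hg₁', hg₂']
  · rintro (_ | _) (_ | _) hij
    exacts [(lt_irrefl _ hij).elim, hlt, absurd hij (by decide), (lt_irrefl _ hij).elim]
  · rintro (_ | _) (_ | _) hij
    exacts [(lt_irrefl _ hij).elim, hlt', absurd hij (by decide), (lt_irrefl _ hij).elim]
  · intro p
    rcases hsurj p with h | h
    exacts [⟨false, h⟩, ⟨true, h⟩]
  · intro p
    rcases hsurj' p with h | h
    exacts [⟨false, h⟩, ⟨true, h⟩]
  · rintro (_ | _)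
    exacts [hm₁, hm₂]
  · rintro (_ | _)
    exacts [hm₁', hm₂']
  · rintro (_ | _)
    exacts [h₁, h₂]

end BinarySum

/-! ### Equivalence of words -/

section Words

variable {A : Type u}

/-- Two finite words satisfy the same sentences, up to a rank `k`. -/
def WordEquiv (k : ℕ) (u v : Word A) : Prop := BackForth (letterAt u) (letterAt v) k ∅

/-- The colour of a word is the set of those finitely many sentences that hold in it. This is the
finite colouring fed to the Ramsey argument. -/
theorem exists_wordEquiv_coloring (A : Type u) [Finite A] (k : ℕ) :
    ∃ (ι : Type u) (_ : Finite ι) (χ : Word A → Set ι), ∀ u v, χ u = χ v → WordEquiv k u v := by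
  obtain ⟨ι, hι, φ, hφ⟩ := exists_formulas_backForth (A := A) k 0
  refine ⟨ι, hι, fun u => {i | RealizeAt (letterAt u) (φ i) default}, fun u v h => ?_⟩
  exact (hφ _ _ (letterAt u) (letterAt v) default default fun i => Set.ext_iff.1 h i).mono
    (empty_subset _)

theorem WordEquiv.refl [Finite A] (k : ℕ) (u : Word A) : WordEquiv k u u := by
  obtain ⟨ι, _, χ, hχ⟩ := exists_wordEquiv_coloring A k
  exact hχ u u rfl

theorem WordEquiv.symm {k : ℕ} {u v : Word A} (h : WordEquiv k u v) : WordEquiv k v u :=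
  (BackForth.symm h).mono (empty_subset _)

theorem WordEquiv.trans {k : ℕ} {u v w : Word A} (h : WordEquiv k u v) (h' : WordEquiv k v w) :
    WordEquiv k u w :=
  (BackForth.trans h h').mono (empty_subset _)

theorem WordEquiv.mul {k : ℕ} {u u' v v' : Word A} (hu : WordEquiv k u u')
    (hv : WordEquiv k v v') : WordEquiv k (u * v) (u' * v') := by
  have hlen : ∀ u v : Word A, (letters (u * v)).length = (letters u).length + (letters v).length :=
    fun u v => by rw [letters_mul, List.length_append]
  let g : ∀ u v : Word A, Fin (letters u).length → Fin (letters (u * v)).length :=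
    fun u v q => ⟨q, by have := hlen u v; omega⟩
  let g' : ∀ u v : Word A, Fin (letters v).length → Fin (letters (u * v)).length :=
    fun u v q => ⟨(letters u).length + q, by have := hlen u v; omega⟩
  have hg : ∀ u v, StrictMono (g u v) := fun u v a b hab => hab
  have hg' : ∀ u v, StrictMono (g' u v) := fun u v a b hab => Nat.add_lt_add_left hab _
  have hlt : ∀ u v q r, g u v q < g' u v r := fun u v q r =>
    Fin.lt_def.2 (q.2.trans_le (Nat.le_add_right _ _))
  have hsurj : ∀ u v p, (∃ q, g u v q = p) ∨ ∃ q, g' u v q = p := by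
    intro u v p
    rcases lt_or_ge (p : ℕ) (letters u).length with h | h
    · exact Or.inl ⟨⟨p, h⟩, rfl⟩
    · have := hlen u v
      exact Or.inr ⟨⟨p - (letters u).length, by omega⟩, Fin.ext (Nat.add_sub_cancel' h)⟩
  have hm : ∀ u v q, letterAt (u * v) (g u v q) = letterAt u q := by
    intro u v q
    simp [letterAt, letters_mul, g]
  have hm' : ∀ u v q, letterAt (u * v) (g' u v q) = letterAt v q := by
    intro u v q
    simp [letterAt, letters_mul, g']
  exact BackForth.sum_two (g u v) (g u' v') (g' u v) (g' u' v') (hg _ _) (hg _ _) (hg' _ _)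
    (hg' _ _) (hlt _ _) (hlt _ _) (hsurj _ _) (hsurj _ _) (hm _ _) (hm _ _) (hm' _ _) (hm' _ _)
    hu hv

theorem BackForth.concat {k : ℕ} {u u' : Word A} {x x' : OmegaWord A} (hu : WordEquiv k u u')
    (hx : BackForth x x' k ∅) : BackForth (concat u x) (concat u' x') k ∅ := by
  have hsurj : ∀ (u : Word A) (p : ℕ), (∃ q : Fin (letters u).length, (q : ℕ) = p) ∨
      ∃ q, (letters u).length + q = p := by
    intro u p
    rcases lt_or_ge p (letters u).length with h | h
    · exact Or.inl ⟨⟨p, h⟩, rfl⟩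
    · exact Or.inr ⟨p - (letters u).length, Nat.add_sub_cancel' h⟩
  have hm : ∀ (u : Word A) (x : OmegaWord A) (q : Fin (letters u).length),
      FOImprint.concat u x q = letterAt u q := by
    intro u x q
    simp [FOImprint.concat, letterAt]
  have hm' : ∀ (u : Word A) (x : OmegaWord A) (q : ℕ),
      FOImprint.concat u x ((letters u).length + q) = x q := by
    intro u x q
    simp [FOImprint.concat]
  exact BackForth.sum_two (fun q : Fin (letters u).length => (q : ℕ))
    (fun q : Fin (letters u').length => (q : ℕ)) (fun q : ℕ => (letters u).length + q)
    (fun q : ℕ => (letters u').length + q) (fun _ _ h => h) (fun _ _ h => h)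
    (fun _ _ h => Nat.add_lt_add_left h _) (fun _ _ h => Nat.add_lt_add_left h _)
    (fun q _ => q.2.trans_le (Nat.le_add_right _ _)) (fun q _ => q.2.trans_le (Nat.le_add_right _ _))
    (hsurj u) (hsurj u') (hm _ _) (hm _ _) (hm' _ _) (hm' _ _) hu hx

/-- The position of `infConcat f` at which the block `f n` starts. -/
def blockStart (f : ℕ → Word A) : ℕ → ℕ
  | 0 => 0
  | n + 1 => blockStart f n + (letters (f n)).length

theorem blockStart_strictMono (f : ℕ → Word A) : StrictMono (blockStart f) :=
  strictMono_nat_of_lt_succ fun n => Nat.lt_add_of_pos_right (letters_length_pos (f n))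

theorem blockStart_succ_eq_length (f : ℕ → Word A) (n : ℕ) :
    blockStart f (n + 1) = (letters (segProd f 0 n)).length := by
  induction n with
  | zero => simp [blockStart, segProd]
  | succ n ih => rw [blockStart, ih, segProd, letters_mul, List.length_append, Nat.zero_add]

theorem infConcat_blockStart_add (f : ℕ → Word A) (n : ℕ) (q : Fin (letters (f n)).length) :
    infConcat f (blockStart f n + q) = letterAt (f n) q := by
  have hlt : blockStart f n + q < (letters (segProd f 0 n)).length := by
    rw [← blockStart_succ_eq_length]
    exact Nat.add_lt_add_left q.2 _
  rw [infConcat_eq f _ n hlt]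
  cases n with
  | zero => simp [blockStart, segProd, letterAt]
  | succ n =>
    simp only [blockStart_succ_eq_length, segProd, letters_mul, letterAt, List.getElem_append]
    simp

theorem exists_blockStart_add (f : ℕ → Word A) (p : ℕ) :
    ∃ n, ∃ q : Fin (letters (f n)).length, blockStart f n + q = p := by
  classical
  have hex : ∃ n, p < blockStart f (n + 1) :=
    -- Blocks are nonempty, so block `p` ends after position `p`.
    ⟨p, (Nat.lt_succ_self p).trans_le ((blockStart_strictMono f).le_apply)⟩
  have h₁ := Nat.find_spec hex
  have h₂ : blockStart f (Nat.find hex) ≤ p := by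
    rcases hn : Nat.find hex with _ | n
    · exact Nat.zero_le _
    · exact not_lt.1 (Nat.find_min hex (m := n) (by omega))
  rw [blockStart] at h₁
  exact ⟨Nat.find hex, ⟨p - blockStart f (Nat.find hex), by omega⟩, Nat.add_sub_cancel' h₂⟩

theorem BackForth.infConcat {k : ℕ} {f f' : ℕ → Word A} (h : ∀ n, WordEquiv k (f n) (f' n)) :
    BackForth (infConcat f) (infConcat f') k ∅ := by
  have hlt : ∀ (f : ℕ → Word A) (i j : ℕ), i < j →
      ∀ (q : Fin (letters (f i)).length) (r : Fin (letters (f j)).length),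
      blockStart f i + q < blockStart f j + r := fun f i j hij q r =>
    (Nat.add_lt_add_left q.2 _).trans_le (((blockStart_strictMono f).monotone
      (show i + 1 ≤ j from hij)).trans (Nat.le_add_right _ _))
  exact (BackForth.sum (g := fun n (q : Fin (letters (f n)).length) => blockStart f n + (q : ℕ))
    (g' := fun n (q : Fin (letters (f' n)).length) => blockStart f' n + (q : ℕ))
    (fun _ _ _ h => Nat.add_lt_add_left h _) (fun _ _ _ h => Nat.add_lt_add_left h _)
    (hlt f) (hlt f') (exists_blockStart_add f) (exists_blockStart_add f')
    (infConcat_blockStart_add f) (infConcat_blockStart_add f') h).mono (empty_subset _)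

/-- The factor of the infinite word `x` that consists of the letters at the positions `p` with
`a ≤ p < b`, if `a < b`. -/
def factor (x : OmegaWord A) (a b : ℕ) : Word A :=
  segProd (fun n => FreeSemigroup.of (x n)) a (b - a - 1)

theorem length_segProd_of (x : OmegaWord A) (a m : ℕ) :
    (letters (segProd (fun n => FreeSemigroup.of (x n)) a m)).length = m + 1 := by
  induction m with
  | zero => rfl
  | succ m ih => rw [segProd, letters_mul, List.length_append, ih]; rfl

theorem letterAt_segProd_of (x : OmegaWord A) (a m : ℕ)
    (q : Fin (letters (segProd (fun n => FreeSemigroup.of (x n)) a m)).length) :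
    letterAt (segProd (fun n => FreeSemigroup.of (x n)) a m) q = x (a + q) := by
  induction m with
  | zero =>
    have hq : (q : ℕ) = 0 := by
      have := q.2.trans_eq (length_segProd_of x a 0)
      omega
    simp only [letterAt, List.get_eq_getElem, hq]
    rfl
  | succ m ih =>
    have hq := q.2.trans_eq (length_segProd_of x a (m + 1))
    have hl := length_segProd_of x a m
    have hb : (q : ℕ) < (letters (segProd (fun n => FreeSemigroup.of (x n)) a m) ++
        letters (FreeSemigroup.of (x (a + (m + 1))))).length := q.2
    change (letters (segProd (fun n => FreeSemigroup.of (x n)) a m) ++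
      letters (FreeSemigroup.of (x (a + (m + 1)))))[(q : ℕ)]'hb = _
    rw [List.getElem_append]
    split_ifs with h
    · exact ih ⟨q, h⟩
    · have e : (q : ℕ) = m + 1 := by omega
      simp [letters, FreeSemigroup.of, e]

theorem length_factor (x : OmegaWord A) {a b : ℕ} (hab : a < b) :
    (letters (factor x a b)).length = b - a := by
  rw [factor, length_segProd_of]
  omega

theorem factor_mul_factor (x : OmegaWord A) {a b c : ℕ} (hab : a < b) (hbc : b < c) :
    factor x a b * factor x b c = factor x a c := by
  have h := segProd_mul (fun n => FreeSemigroup.of (x n)) a (b - a - 1) (c - b - 1)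
  have e₁ : a + (b - a - 1) + 1 = b := by omega
  have e₂ : b - a - 1 + (c - b - 1) + 1 = c - a - 1 := by omega
  rw [e₁, e₂] at h
  exact h

/-- Once both endpoints are matched, moves between them must be answered between the matched
endpoints, so the remaining rounds form a game on the factors. -/
theorem WordEquiv.of_backForth {k : ℕ} {x x' : OmegaWord A} {R : Set (ℕ × ℕ)}
    (h : BackForth x x' k R) {a a' b b' : ℕ} (ha : (a, a') ∈ R) (hb : (b, b') ∈ R) (hab : a < b) :
    WordEquiv k (factor x a b) (factor x' a' b') := by
  have hab' : a' < b' := (h.atomEquiv.2 _ ha _ hb).1 hab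
  -- The lower bound is written `¬ p < a` because `AtomEquiv` transfers strict comparisons only.
  have hrange : ∀ (x : OmegaWord A) {a b : ℕ}, a < b → ∀ p,
      (p ∈ range fun q : Fin (letters (factor x a b)).length => a + (q : ℕ)) ↔ ¬ p < a ∧ p < b := by
    intro x a b hab p
    have hl := length_factor x hab
    constructor
    · rintro ⟨q, rfl⟩
      have := q.2
      simp only
      omega
    · rintro ⟨h₁, h₂⟩
      exact ⟨⟨p - a, by omega⟩, by simp only; omega⟩
  have key := BackForth.restrict
    (g := fun q : Fin (letters (factor x a b)).length => a + (q : ℕ))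
    (g' := fun q : Fin (letters (factor x' a' b')).length => a' + (q : ℕ))
    (fun _ _ h => Nat.add_lt_add_left h _) (fun _ _ h => Nat.add_lt_add_left h _)
    (R₀ := {(a, a'), (b, b')}) (ℓ := x) (ℓ' := x') ?_ ?_ h
  · have e : ∀ (x : OmegaWord A) (a b : ℕ),
        letterAt (factor x a b) =
          x ∘ fun q : Fin (letters (factor x a b)).length => a + (q : ℕ) :=
      fun x a b => funext fun q => letterAt_segProd_of x a _ q
    rw [WordEquiv, e x a b, e x' a' b']
    exact key.mono (empty_subset _)
  · intro p p' hp
    rw [hrange x hab, hrange x' hab']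
    exact and_congr (hp.2 (p, p') (by simp) (a, a') (by simp)).not
      (hp.2 (p, p') (by simp) (b, b') (by simp))
  · rintro _ (rfl | rfl)
    exacts [ha, hb]

end Words

/-! ### Optimal imprints and back-and-forth equivalence -/

section Imprint

variable {A : Type u} {X : Type v} {Y : Type w} {P : X → Type} [∀ x, LinearOrder (P x)]

/-- The class of first-order definable sets of labelled orders, for a family `ℓ` of labelled
orders that is indexed by `X`. -/
def foClass (ℓ : ∀ x, P x → A) : Set (Set X) :=
  {L | ∃ φ : (wordLang A).Sentence, L = {x | Satisfies (ℓ x) φ}}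

theorem exists_backForth_mem_iff {ℓ : ∀ x, P x → A} {L : Set X} (hL : L ∈ foClass ℓ) :
    ∃ k, ∀ x y, BackForth (ℓ x) (ℓ y) k ∅ → (x ∈ L ↔ y ∈ L) := by
  obtain ⟨φ, rfl⟩ := hL
  obtain ⟨k, hk⟩ := exists_backForth_realizeAt φ
  exact ⟨k, fun x y h => hk _ _ (ℓ x) (ℓ y) default default (by rwa [range_eq_empty])⟩

/-- The equivalence classes of some rank refine a given first-order partition. -/
theorem IsClassPartition.exists_backForth_subset {ℓ : ∀ x, P x → A} {K : Set (Set X)}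
    (hK : IsClassPartition (foClass ℓ) K) :
    ∃ k, ∀ x, ∃ L ∈ K, {y | BackForth (ℓ x) (ℓ y) k ∅} ⊆ L := by
  choose! r hr using fun L (hL : L ∈ K) => exists_backForth_mem_iff (hK.2.2 hL)
  -- The partition is finite, so one rank serves all its blocks.
  obtain ⟨k, hk⟩ := (hK.1.image r).bddAbove
  refine ⟨k, fun x => ?_⟩
  obtain ⟨L, ⟨hL, hx⟩, -⟩ := hK.2.1.2 x
  exact ⟨L, hL, fun y hy => (hr L hL x y (hy.of_le (hk (mem_image_of_mem r hL)))).1 hx⟩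

/-- Some first-order partition refines the equivalence of a given rank. -/
theorem exists_isClassPartition_backForth [Finite A] (ℓ : ∀ x, P x → A) (k : ℕ) :
    ∃ K, IsClassPartition (foClass ℓ) K ∧
      ∀ L ∈ K, ∀ x ∈ L, ∀ y ∈ L, BackForth (ℓ x) (ℓ y) k ∅ := by
  classical
  obtain ⟨ι, _, φ, hφ⟩ := exists_formulas_backForth (A := A) k 0
  let χ : X → Set ι := fun x => {i | RealizeAt (ℓ x) (φ i) default}
  refine ⟨(Setoid.ker χ).classes, ⟨Setoid.finite_classes_ker χ, Setoid.isPartition_classes _, ?_⟩,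
    ?_⟩
  · rintro _ ⟨x, rfl⟩
    refine ⟨FirstOrder.Language.BoundedFormula.iInf fun i => if i ∈ χ x then φ i else (φ i).not, ?_⟩
    ext y
    rw [mem_ofPred_eq, mem_ofPred_eq, satisfies_iff_realizeAt]
    simp only [RealizeAt, FirstOrder.Language.BoundedFormula.realize_iInf]
    rw [Setoid.ker_def, Set.ext_iff]
    refine forall_congr' fun i => ?_
    by_cases hi : i ∈ χ x
    · simp only [hi, iff_true, if_true]
      rfl
    · simp only [hi, iff_false, if_false, FirstOrder.Language.BoundedFormula.realize_not]
      rfl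
  · rintro _ ⟨z, rfl⟩ x hx y hy
    have hxy : χ x = χ y := Eq.trans (show χ x = χ z from hx) (show χ y = χ z from hy).symm
    exact (hφ _ _ (ℓ x) (ℓ y) default default fun i => Set.ext_iff.1 hxy i).mono (empty_subset _)

/-- The imprint of an optimal partition is contained in that of any other, in particular of one
whose blocks lie in rank-`k` classes. -/
theorem exists_subset_image_backForth [Finite A] {ℓ : ∀ x, P x → A} {α : X → Y} {T : Set Y}
    (hT : T ∈ optimalImprint (foClass ℓ) α) (k : ℕ) :
    ∃ x, T ⊆ α '' {y | BackForth (ℓ x) (ℓ y) k ∅} := by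
  obtain ⟨K, hK, hTK⟩ := hT
  obtain ⟨K', hK', hk⟩ := exists_isClassPartition_backForth ℓ k
  obtain ⟨L, hL, hTL⟩ := hK.2 K' hK' hTK
  obtain ⟨x, hx⟩ := nonempty_iff_ne_empty.2 fun h : L = ∅ => hK'.2.1.1 (h ▸ hL)
  exact ⟨x, hTL.trans (image_mono fun y hy => hk L hL x hx y hy)⟩

/-- Take `k` such that the rank-`k` classes refine an optimal partition. -/
theorem exists_image_backForth_mem {ℓ : ∀ x, P x → A} {α : X → Y}
    (hopt : ∃ K, IsOptimal (foClass ℓ) α K) :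
    ∃ k, ∀ x, α '' {y | BackForth (ℓ x) (ℓ y) k ∅} ∈ optimalImprint (foClass ℓ) α := by
  obtain ⟨K, hK⟩ := hopt
  obtain ⟨k, hk⟩ := hK.1.exists_backForth_subset
  refine ⟨k, fun x => ?_⟩
  obtain ⟨L, hL, hxL⟩ := hk x
  exact ⟨K, hK, L, hL, image_mono hxL⟩

theorem optimalImprint_downward {C : Set (Set X)} {α : X → Y} {T T' : Set Y}
    (hT : T ∈ optimalImprint C α) (h : T' ⊆ T) : T' ∈ optimalImprint C α := by
  obtain ⟨K, hK, L, hL, hTL⟩ := hT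
  exact ⟨K, hK, L, hL, h.trans hTL⟩

end Imprint

/-! ### Optimal imprints on finite and infinite words -/

section WordImprint

variable {A : Type u} {Y : Type v}

theorem exists_subset_image_wordEquiv [Finite A] {α : Word A → Y} {T : Set Y}
    (hT : T ∈ optimalImprint (foWord A) α) (k : ℕ) : ∃ u, T ⊆ α '' {v | WordEquiv k u v} :=
  exists_subset_image_backForth (ℓ := fun w : Word A => letterAt w) hT k

theorem exists_image_wordEquiv_mem [Finite Y] (α : Word A → Y) :
    ∃ k, ∀ u, α '' {v | WordEquiv k u v} ∈ optimalImprint (foWord A) α :=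
  exists_image_backForth_mem (ℓ := fun w : Word A => letterAt w) (exists_isOptimal_foWord α)

theorem mem_optimalImprint_foOmega_iff [Finite A] [Finite Y] {α : OmegaWord A → Y} {T : Set Y} :
    T ∈ optimalImprint (foOmega A) α ↔ ∀ k, ∃ x : OmegaWord A, T ⊆ α '' {y | BackForth x y k ∅} := by
  refine ⟨fun hT k => exists_subset_image_backForth (P := fun _ => ℕ)
    (ℓ := fun x : OmegaWord A => x) hT k, fun h => ?_⟩
  obtain ⟨k, hk⟩ := exists_image_backForth_mem (P := fun _ => ℕ)
    (ℓ := fun x : OmegaWord A => x) (exists_isOptimal_foOmega α)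
  obtain ⟨x, hx⟩ := h k
  exact optimalImprint_downward (hk x) hx

end WordImprint

/-! ### The optimal imprint on infinite words is saturated -/

theorem isSaturated_optimalImprint {A : Type u} [Finite A] {S : Type v} {T : Type w} [Semigroup S]
    [OmegaSemigroup S T] [Finite S] [Finite T] (α : OmegaHom (Word A) (OmegaWord A) S T) :
    IsSaturated (optimalImprint (foWord A) α.fin) (optimalImprint (foOmega A) α.inf) := by
  refine ⟨fun R hR => ?_, fun R hR U hU => ?_, fun U hU V hV => optimalImprint_downward hU hV⟩
  · refine mem_optimalImprint_foOmega_iff.2 fun k => ?_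
    obtain ⟨u, hu⟩ := exists_subset_image_wordEquiv hR k
    refine ⟨infConcat fun _ => u, ?_⟩
    rintro _ ⟨f, hf, rfl⟩
    -- Every factor is the value of a word equivalent to the same `u`, so every product is the value
    -- of a word equivalent to `u u u ⋯`.
    choose v hv hvf using fun n => hu (hf n)
    refine ⟨infConcat v, BackForth.infConcat hv, ?_⟩
    exact (α.map_infProd v).trans (congrArg _ (funext hvf))
  · refine mem_optimalImprint_foOmega_iff.2 fun k => ?_
    obtain ⟨u, hu⟩ := exists_subset_image_wordEquiv hR k
    obtain ⟨x, hx⟩ := mem_optimalImprint_foOmega_iff.1 hU k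
    refine ⟨concat u x, ?_⟩
    rintro _ ⟨s, hs, t, ht, rfl⟩
    obtain ⟨v, hv, rfl⟩ := hu hs
    obtain ⟨y, hy, rfl⟩ := hx ht
    exact ⟨concat v y, BackForth.concat hv hy, α.map_mixed v y⟩

/-! ### Factorizations of infinite words into equivalent words -/

section Factorization

variable {A : Type u}

/-- The position `a` of `x` is positive, the prefix of `x` before `a` is equivalent to `u`, and
infinitely many factors that start at `a` are equivalent to `v` and end at a position that merges
with `a`. -/
def Factorizes (k : ℕ) (u v : Word A) (x : OmegaWord A) : Prop :=
  ∃ a, 0 < a ∧ WordEquiv k u (factor x 0 a) ∧ ∀ b, ∃ c, b < c ∧ a < c ∧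
    WordEquiv k v (factor x a c) ∧ ∃ d, c < d ∧ WordEquiv k (factor x a d) (factor x c d)

/-- Ramsey's argument with a nonprincipal ultrafilter: `e a` is the colour of almost all factors
that start at `a`, and `e₀` is the value of `e` at almost all positions. Any finitely many such
conditions hold together at arbitrarily late positions. -/
theorem exists_factorizes [Finite A] (k : ℕ) (x : OmegaWord A) : ∃ u v, Factorizes k u v x := by
  obtain ⟨ι, _, χ, hχ⟩ := exists_wordEquiv_coloring A k
  have hU : ∀ b : ℕ, ∀ᶠ a in Filter.hyperfilter ℕ, b < a := fun b =>
    Nat.hyperfilter_le_atTop (Filter.eventually_gt_atTop b)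
  have key : ∀ f : ℕ → Set ι, ∃ e, ∀ᶠ n in Filter.hyperfilter ℕ, f n = e := by
    intro f
    have h : (⋃ e ∈ (univ : Set (Set ι)), {n | f n = e}) ∈ Filter.hyperfilter ℕ :=
      Filter.mem_of_superset Filter.univ_mem fun n _ => by simp
    obtain ⟨e, -, he⟩ := (Ultrafilter.finite_biUnion_mem_iff (Set.toFinite _)).1 h
    exact ⟨e, he⟩
  choose e he using fun a => key fun b => χ (factor x a b)
  obtain ⟨e₀, he₀⟩ := key e
  obtain ⟨a, ha, ha₀⟩ := ((hU 0).and he₀).exists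
  obtain ⟨m, hm⟩ := (he a).exists
  rw [ha₀] at hm
  refine ⟨factor x 0 a, factor x a m, a, ha, WordEquiv.refl k _, fun b => ?_⟩
  obtain ⟨c, hbc, hac, hc, hc₀⟩ := ((hU b).and ((hU a).and ((he a).and he₀))).exists
  -- Since `e a = e c = e₀`, almost every `d` witnesses that `c` merges with `a`.
  obtain ⟨d, hcd, hd, hd'⟩ := ((hU c).and ((he a).and (he c))).exists
  exact ⟨c, hbc, hac, hχ _ _ (by rw [hm, hc, ha₀]), d, hcd, hχ _ _ (by rw [hd, hd', ha₀, hc₀])⟩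

/-- Five rounds are spent on the positions `0`, `a`, `b`, `c`, `d`; the remaining `k` compare the
factors between them. -/
theorem Factorizes.of_backForth {k : ℕ} {u v : Word A} {x x' : OmegaWord A}
    (h : Factorizes k u v x) (hx : BackForth x x' (k + 5) ∅) : Factorizes k u v x' := by
  obtain ⟨a, ha, hu, H⟩ := h
  obtain ⟨z, hz⟩ := hx.2.2 0
  -- The first position must be matched with the first one: otherwise Spoiler plays below it and
  -- Duplicator has no reply.
  obtain rfl : z = 0 := by
    obtain ⟨z', hz'⟩ := hz.2.1 0
    by_contra hne
    exact Nat.not_lt_zero _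
      ((hz'.atomEquiv.2 (0, z') (by simp) (z, 0) (by simp)).1 (Nat.pos_of_ne_zero hne))
  obtain ⟨a', ha'⟩ := hz.2.1 a
  refine ⟨a', (ha'.atomEquiv.2 (0, 0) (by simp) (a, a') (by simp)).1 ha,
    hu.trans (WordEquiv.of_backForth (ha'.of_le (by omega)) (by simp) (by simp) ha),
    fun b' => ?_⟩
  -- The bound is universally quantified, so it is chosen in `x'` and answered in `x`.
  obtain ⟨b, hb⟩ := ha'.2.2 b'
  obtain ⟨c, hbc, hac, hv, d, hcd, hd⟩ := H b
  obtain ⟨c', hc'⟩ := hb.2.1 c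
  obtain ⟨d', hd'⟩ := hc'.2.1 d
  have hW : ∀ {p p' q q'}, (p, p') ∈ ({(d, d'), (c, c'), (b, b'), (a, a'), (0, 0)} : Set (ℕ × ℕ)) →
      (q, q') ∈ ({(d, d'), (c, c'), (b, b'), (a, a'), (0, 0)} : Set (ℕ × ℕ)) → p < q →
      p' < q' ∧ WordEquiv k (factor x p q) (factor x' p' q') := by
    intro p p' q q' hp hq hpq
    -- The game starts from `∅`, so its set of pairs ends in `insert (0, 0) ∅` and not in a
    -- singleton.
    rw [← insert_empty_eq] at hp hq
    exact ⟨(hd'.atomEquiv.2 _ hp _ hq).1 hpq, WordEquiv.of_backForth hd' hp hq hpq⟩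
  have h₁ := hW (p := a) (p' := a') (q := c) (q' := c') (by simp) (by simp) hac
  have h₂ := hW (p := c) (p' := c') (q := d) (q' := d') (by simp) (by simp) hcd
  have h₃ := hW (p := a) (p' := a') (q := d) (q' := d') (by simp) (by simp) (hac.trans hcd)
  have h₄ := hW (p := b) (p' := b') (q := c) (q' := c') (by simp) (by simp) hbc
  exact ⟨c', h₄.1, h₁.1, hv.trans h₁.2, d', h₂.1, h₃.2.symm.trans (hd.trans h₂.2)⟩

/-- A factorized word is a product of a word equivalent to `u` and words equivalent to `v`. -/
theorem Factorizes.exists_seq [Finite A] {k : ℕ} {u v : Word A} {x : OmegaWord A}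
    (h : Factorizes k u v x) :
    ∃ s : ℕ → ℕ, StrictMono s ∧ s 0 = 0 ∧ WordEquiv k u (factor x (s 0) (s 1)) ∧
      ∀ n, WordEquiv k v (factor x (s (n + 1)) (s (n + 2))) := by
  obtain ⟨a, ha, hu, H⟩ := h
  -- `G` holds `a` and the positions merged with `a`; from each of them the construction can
  -- continue inside `G`.
  let G : Set ℕ := {c | c = a ∨ a < c ∧ ∃ d, c < d ∧ WordEquiv k (factor x a d) (factor x c d)}
  have hG : ∀ c : G, ∃ c' : G, (c : ℕ) < c' ∧ WordEquiv k v (factor x c c') := by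
    rintro ⟨c, rfl | ⟨hac, d, hcd, hd⟩⟩
    · obtain ⟨b, h₁, h₂, h₃, h₄⟩ := H c
      exact ⟨⟨b, Or.inr ⟨h₂, h₄⟩⟩, h₁, h₃⟩
    · obtain ⟨b, h₁, h₂, h₃, h₄⟩ := H d
      refine ⟨⟨b, Or.inr ⟨h₂, h₄⟩⟩, hcd.trans h₁, h₃.trans ?_⟩
      rw [← factor_mul_factor x (hac.trans hcd) h₁, ← factor_mul_factor x hcd h₁]
      exact hd.mul (WordEquiv.refl k _)
  choose next hlt hnext using hG
  let t : ℕ → G := fun n => next^[n] ⟨a, Or.inl rfl⟩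
  have ht : ∀ n, t (n + 1) = next (t n) := fun n => Function.iterate_succ_apply' _ _ _
  -- The cut points are `0`, then `a` and its iterates under `next`.
  refine ⟨fun n => Nat.casesOn n 0 fun m => t m, strictMono_nat_of_lt_succ fun n => ?_, rfl, hu,
    fun n => ?_⟩
  · cases n with
    | zero => exact ha
    | succ n =>
      change (t n : ℕ) < t (n + 1)
      rw [ht]
      exact hlt _
  · change WordEquiv k v (factor x (t n) (t (n + 1)))
    rw [ht]
    exact hnext _

end Factorization

/-! ### The value of a factorized infinite word -/

theorem map_segProd {S S' : Type*} [Semigroup S] [Semigroup S'] (α : S →ₙ* S') (f : ℕ → S)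
    (i m : ℕ) : α (segProd f i m) = segProd (fun n => α (f n)) i m := by
  induction m with
  | zero => rfl
  | succ m ih => rw [segProd, map_mul, ih, segProd]

theorem infConcat_of {A : Type u} (x : OmegaWord A) :
    infConcat (fun n => FreeSemigroup.of (x n)) = x := by
  funext p
  have h := letterAt_segProd_of x 0 p ⟨p, lt_length_segProd _ 0 p⟩
  rw [Nat.zero_add] at h
  exact h

theorem Factorizes.map_mem {A : Type u} [Finite A] {S : Type v} {T : Type w} [Semigroup S]
    [OmegaSemigroup S T] (α : OmegaHom (Word A) (OmegaWord A) S T) {k : ℕ} {u v : Word A}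
    {x : OmegaWord A} (h : Factorizes k u v x) :
    α.inf x ∈ setMixed (α.fin '' {w | WordEquiv k u w})
      (setInfPow T (α.fin '' {w | WordEquiv k v w})) := by
  obtain ⟨s, hs, hs₀, hu, hv⟩ := h.exists_seq
  have e : α.inf x = OmegaSemigroup.infProd fun n => α.fin (factor x (s n) (s (n + 1))) := by
    -- The word is the infinite product of its letters, and block associativity regroups their
    -- images along `s`.
    have h₁ := α.map_infProd fun n => FreeSemigroup.of (x n)
    rw [show OmegaSemigroup.infProd (fun n => FreeSemigroup.of (x n)) = x from infConcat_of x,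
      ← OmegaSemigroup.infProd_blocks _ s hs hs₀] at h₁
    simpa only [factor, map_segProd] using h₁
  refine ⟨_, ⟨_, hu, rfl⟩, _, ⟨fun n => α.fin (factor x (s (n + 1)) (s (n + 2))),
    fun n => ⟨_, hv n, rfl⟩, rfl⟩, ?_⟩
  rw [e, OmegaSemigroup.mixed_infProd]
  congr 1
  funext n
  cases n <;> rfl

end FOImprint

/-! ### The proposition -/

theorem mainTheorem6 {A : Type u} [Finite A] {S : Type v} {T : Type w} [Semigroup S]
    [FOImprint.OmegaSemigroup S T] [Finite S] [Finite T]
    (α : FOImprint.OmegaHom (FOImprint.Word A) (FOImprint.OmegaWord A) S T) :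
    FOImprint.optimalImprint (FOImprint.foOmega A) α.inf =
      FOImprint.satInf T (FOImprint.optimalImprint (FOImprint.foWord A) α.fin) := by
  refine Set.Subset.antisymm (fun U hU => ?_)
    ((FOImprint.satInf_isLeast T _).2 (FOImprint.isSaturated_optimalImprint α))
  obtain ⟨k, hk⟩ := FOImprint.exists_image_wordEquiv_mem α.fin
  -- The five extra ranks let every word in the class of `x` inherit its factorization at rank `k`.
  obtain ⟨x, hx⟩ := FOImprint.mem_optimalImprint_foOmega_iff.1 hU (k + 5)
  obtain ⟨u, v, huv⟩ := FOImprint.exists_factorizes k x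
  have hsat := (FOImprint.satInf_isLeast T (FOImprint.optimalImprint (FOImprint.foWord A) α.fin)).1
  refine hsat.2.2 _ (hsat.2.1 _ (hk u) _ (hsat.1 _ (hk v))) U (hx.trans ?_)
  rintro _ ⟨y, hy, rfl⟩
  exact (huv.of_backForth hy).map_mem α
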